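/- Let $G$ be a finite group of order $n$ and let $V$ be a simple $\mathbb{C}[G]$-module of dimension $d$ over $\mathbb{C}$. Let $e$ be a natural number with $d(d+e)=n$, and suppose that $e>1$ and that $e$ is not a power of $2$. Then $$n \le ((2e)!)^2 .$$ Moreover, if there is a normal subgroup $N\neq\{1\}$ of $G$ that acts trivially on every simple $\mathbb{C}[G]$-module not isomorphic to $V$, then $n<e^6$. -/

import Mathlib

universe u v

/-- The subgroup `N` of `G` acts trivially on every simple `ℂ[G]`-module that is not isomorphic
to the module given by `ρ`.  Simple `ℂ[G]`-modules are irreducible complex representations.  When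
`G` is finite each of them is isomorphic to a submodule of `ℂ[G]`, so it is enough to let them
range over the universe of `G`. -/
def ActsTriviallyOnOtherSimples {G : Type u} [Group G] {V : Type v} [AddCommGroup V] [Module ℂ V]
    (N : Subgroup G) (ρ : Representation ℂ G V) : Prop :=
  ∀ (W : Type u) [AddCommGroup W] [Module ℂ W] (σ : Representation ℂ G W),
    σ.IsIrreducible → IsEmpty (Representation.Equiv ρ σ) → ∀ g ∈ N, σ g = 1

/-! Let `χ` be the character of `V`. If `d < 4e³`, then `n = d(d + e) ≤ 20e⁶`, and this is below
`((2e)!)²`. If `d ≥ 4e³`, every other simple `W` has dimension `m` with `m² ≤ n - d² = de`, so `2em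
< d + e`. The multiplicity `k` of the trivial module in `End(V) ⊗ W` is the average of `|χ|²ψ`,
where `ψ` is the character of `W`. The identity contributes nothing to the average of `|χ|²(m - Re
ψ)`, so `m - k ≤ 2em/(d + e) < 1`. Integrality forces `k = m`, and `W` is trivial wherever `χ ≠ 0`.
Were the common kernel `N` of the other simples trivial, `χ` would live at `1` and `n = d²`, which
is impossible. So large `d` reduces to the second claim.

Given `N` with `|N| = q`, `d·χ` is the regular character of `G` minus that of `G/N`. Hence `d = e(q
- 1)`, `n = e²q(q - 1)`, `N \ {1}` is one conjugacy class, and each coset `gN ≠ N` lies in one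
class. Then `N` is an elementary abelian `p`-group whose nontrivial elements have centralizers of
order `e²q`, a power of `p`. So `e` is a power of `p`, and `p` is odd.

For `g ∉ N`, every `p`-subgroup of `C(g)` has order dividing `e²`. An argument with an involution
inverting `N` finds such a `g` centralizing `N`, so `q ≤ e²` and `n < e⁶`. -/

/-! ### Unitarity, orthogonality and degree estimates -/

open Module Matrix ComplexOrder MatrixOrder in
theorem Representation.exists_unitary_matrix {G V : Type*} [Group G] [Finite G] [AddCommGroup V]
    [Module ℂ V] [FiniteDimensional ℂ V] (ρ : Representation ℂ G V) (g : G) :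
    ∃ U : Matrix (Fin (finrank ℂ V)) (Fin (finrank ℂ V)) ℂ, Uᴴ * U = 1 ∧
      U.trace = ρ.character g ∧ Uᴴ.trace = ρ.character g⁻¹ ∧ (U = 1 → ρ g = 1) := by
  classical
  have := Fintype.ofFinite G
  let b := finBasis ℂ V
  let M : G → Matrix (Fin (finrank ℂ V)) (Fin (finrank ℂ V)) ℂ := fun g => LinearMap.toMatrix b b (ρ g)
  have hM1 : M 1 = 1 := by simp [M]
  have hMmul : ∀ g h, M (g * h) = M g * M h := fun g h => by
    simp only [M, map_mul, LinearMap.toMatrix_mul]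
  -- Averaging over `G` gives an invariant positive definite form; conjugating by its square root
  -- makes `M g` unitary.
  let H := ∑ h, (M h)ᴴ * M h
  have hH : H.PosDef := by
    have : H = (M 1)ᴴ * M 1 + ∑ h ∈ Finset.univ.erase 1, (M h)ᴴ * M h :=
      (Finset.add_sum_erase _ _ (Finset.mem_univ 1)).symm
    rw [this]
    refine PosDef.add_posSemidef ?_ ?_
    · rw [hM1]; simpa using PosDef.one
    · exact posSemidef_sum _ fun i _ => posSemidef_conjTranspose_mul_self _
  have hHg : (M g)ᴴ * H * M g = H := by
    simp only [H, Finset.mul_sum, Finset.sum_mul]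
    rw [← Equiv.sum_comp (Equiv.mulRight g) (fun h => (M h)ᴴ * M h)]
    refine Finset.sum_congr rfl fun h _ => ?_
    simp only [Equiv.coe_mulRight, hMmul, conjTranspose_mul, Matrix.mul_assoc]
  obtain ⟨S, hS, hSH⟩ : ∃ S : Matrix (Fin (finrank ℂ V)) (Fin (finrank ℂ V)) ℂ,
      IsUnit S ∧ H = Sᴴ * S := by
    have h0 : 0 ≤ H := hH.posSemidef.nonneg
    have h1 : CFC.sqrt H * CFC.sqrt H = H := CFC.sqrt_mul_sqrt_self H h0
    have h2 : (CFC.sqrt H)ᴴ = CFC.sqrt H := (CFC.sqrt_nonneg H).isSelfAdjoint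
    refine ⟨CFC.sqrt H, isUnit_of_mul_isUnit_left (y := CFC.sqrt H) (h1.symm ▸ hH.isUnit), ?_⟩
    rw [h2, h1]
  have hS' : S * S⁻¹ = 1 := mul_nonsing_inv _ ((isUnit_iff_isUnit_det _).1 hS)
  have hS'' : S⁻¹ * S = 1 := nonsing_inv_mul _ ((isUnit_iff_isUnit_det _).1 hS)
  have hU : (S * M g * S⁻¹)ᴴ * (S * M g * S⁻¹) = 1 := by
    calc _ = (S⁻¹)ᴴ * ((M g)ᴴ * (Sᴴ * S) * M g) * S⁻¹ := by
          simp only [conjTranspose_mul, Matrix.mul_assoc]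
      _ = (S⁻¹)ᴴ * (Sᴴ * S) * S⁻¹ := by rw [← hSH, hHg]
      _ = (S * S⁻¹)ᴴ * (S * S⁻¹) := by simp only [conjTranspose_mul, Matrix.mul_assoc]
      _ = 1 := by simp [hS']
  refine ⟨S * M g * S⁻¹, hU, ?_, ?_, ?_⟩
  · rw [trace_mul_comm, ← Matrix.mul_assoc, hS'', Matrix.one_mul, Representation.character,
      LinearMap.trace_eq_matrix_trace ℂ b]
  · have : (S * M g * S⁻¹)ᴴ = S * M g⁻¹ * S⁻¹ := by
      refine left_inv_eq_right_inv hU ?_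
      calc S * M g * S⁻¹ * (S * M g⁻¹ * S⁻¹) = S * (M g * ((S⁻¹ * S) * M g⁻¹)) * S⁻¹ := by
            simp only [Matrix.mul_assoc]
        _ = 1 := by rw [hS'', Matrix.one_mul, ← hMmul, mul_inv_cancel, hM1, Matrix.mul_one, hS']
    rw [this, trace_mul_comm, ← Matrix.mul_assoc, hS'', Matrix.one_mul, Representation.character,
      LinearMap.trace_eq_matrix_trace ℂ b]
  · intro h
    have hMg : M g = 1 := by
      calc M g = (S⁻¹ * S) * M g * (S⁻¹ * S) := by simp [hS'']
        _ = S⁻¹ * (S * M g * S⁻¹) * S := by simp only [Matrix.mul_assoc]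
        _ = 1 := by rw [h, Matrix.mul_one, hS'']
    apply (LinearMap.toMatrix b b).injective
    simpa [M] using hMg

open ComplexConjugate in
theorem Representation.character_inv_eq_conj {G V : Type*} [Group G] [Finite G] [AddCommGroup V]
    [Module ℂ V] [FiniteDimensional ℂ V] (ρ : Representation ℂ G V) (g : G) :
    ρ.character g⁻¹ = conj (ρ.character g) := by
  obtain ⟨U, -, h1, h2, -⟩ := ρ.exists_unitary_matrix g
  rw [← h1, ← h2, Matrix.trace_conjTranspose]; rfl

-- For unitary `U`, the trace of `(U ± 1)ᴴ(U ± 1)` is `2 dim V ± 2 Re χ(g)`, and it is nonnegative.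
-- The equality case yields the next lemma.
open Matrix ComplexOrder in
theorem Representation.abs_re_character_le {G V : Type*} [Group G] [Finite G] [AddCommGroup V]
    [Module ℂ V] [FiniteDimensional ℂ V] (ρ : Representation ℂ G V) (g : G) :
    |(ρ.character g).re| ≤ Module.finrank ℂ V := by
  obtain ⟨U, hU, h1, h2, -⟩ := ρ.exists_unitary_matrix g
  have h3 := (posSemidef_conjTranspose_mul_self (U - 1)).trace_nonneg
  have h4 := (posSemidef_conjTranspose_mul_self (U + 1)).trace_nonneg
  rw [conjTranspose_sub, conjTranspose_one, sub_mul, mul_sub, hU] at h3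
  rw [conjTranspose_add, conjTranspose_one, add_mul, mul_add, hU] at h4
  simp only [Matrix.mul_one, Matrix.one_mul, trace_sub, trace_add, trace_one, h1, h2,
    character_inv_eq_conj, Complex.le_def] at h3 h4
  simp at h3 h4
  rw [abs_le]
  constructor <;> linarith

open Matrix ComplexOrder in
theorem Representation.eq_one_of_re_character_eq {G V : Type*} [Group G] [Finite G] [AddCommGroup V]
    [Module ℂ V] [FiniteDimensional ℂ V] (ρ : Representation ℂ G V) (g : G)
    (hg : (ρ.character g).re = Module.finrank ℂ V) : ρ g = 1 := by
  obtain ⟨U, hU, h1, h2, h3⟩ := ρ.exists_unitary_matrix g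
  refine h3 (sub_eq_zero.1 ((trace_conjTranspose_mul_self_eq_zero_iff (A := U - 1)).1 ?_))
  rw [conjTranspose_sub, conjTranspose_one, sub_mul, mul_sub, hU]
  simp only [Matrix.mul_one, Matrix.one_mul, trace_sub, trace_one, h1, h2,
    character_inv_eq_conj]
  apply Complex.ext <;> simp [hg]

theorem Representation.character_mul_inv_eq_normSq {G V : Type*} [Group G] [Finite G]
    [AddCommGroup V] [Module ℂ V] [FiniteDimensional ℂ V] (ρ : Representation ℂ G V) (g : G) :
    ρ.character g * ρ.character g⁻¹ = Complex.normSq (ρ.character g) := by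
  rw [character_inv_eq_conj, Complex.mul_conj]

theorem Representation.sum_character_mul_inv_self {G V : Type*} [Group G] [Fintype G]
    [AddCommGroup V] [Module ℂ V] [FiniteDimensional ℂ V] (ρ : Representation ℂ G V)
    [ρ.IsIrreducible] : ∑ g, ρ.character g * ρ.character g⁻¹ = Nat.card G := by
  have h0 : (Nat.card G : ℂ) ≠ 0 := by exact_mod_cast Nat.card_pos.ne'
  have := invertibleOfNonzero h0
  have h := char_orthonormal ρ ρ
  rw [if_pos ⟨Equiv.refl ρ⟩, inv_mul_eq_iff_eq_mul₀ h0, mul_one] at h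
  exact h

theorem Representation.sum_character_mul_inv_of_isEmpty {G V W : Type*} [Group G] [Fintype G]
    [AddCommGroup V] [Module ℂ V] [FiniteDimensional ℂ V] (ρ : Representation ℂ G V)
    [AddCommGroup W] [Module ℂ W] [FiniteDimensional ℂ W] (σ : Representation ℂ G W)
    [ρ.IsIrreducible] [σ.IsIrreducible] (h : IsEmpty (Equiv ρ σ)) :
    ∑ g, σ.character g * ρ.character g⁻¹ = 0 := by
  have h0 : (Nat.card G : ℂ) ≠ 0 := by exact_mod_cast Nat.card_pos.ne'
  have := invertibleOfNonzero h0
  have h := char_orthonormal σ ρ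
  rw [if_neg (by rwa [not_nonempty_iff]), inv_mul_eq_iff_eq_mul₀ h0, mul_zero] at h
  exact h

theorem Representation.sum_normSq_character {G V : Type*} [Group G] [Fintype G]
    [AddCommGroup V] [Module ℂ V] [FiniteDimensional ℂ V] (ρ : Representation ℂ G V)
    [ρ.IsIrreducible] : ∑ g, Complex.normSq (ρ.character g) = Nat.card G := by
  have h := ρ.sum_character_mul_inv_self
  simp only [character_mul_inv_eq_normSq] at h
  exact_mod_cast h

/-- The degrees of two inequivalent irreducible representations satisfy `d² + m² ≤ |G|`. -/
theorem Representation.finrank_sq_add_finrank_sq_le {G V W : Type*} [Group G] [Finite G]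
    [AddCommGroup V] [Module ℂ V] [FiniteDimensional ℂ V] (ρ : Representation ℂ G V)
    [AddCommGroup W] [Module ℂ W] [FiniteDimensional ℂ W] (σ : Representation ℂ G W)
    [ρ.IsIrreducible] [σ.IsIrreducible] (h : IsEmpty (Equiv ρ σ)) :
    Module.finrank ℂ V ^ 2 + Module.finrank ℂ W ^ 2 ≤ Nat.card G := by
  have := Fintype.ofFinite G
  set d := Module.finrank ℂ V with hd
  set m := Module.finrank ℂ W with hm
  have h12 := sum_character_mul_inv_of_isEmpty ρ σ h
  have h21 := sum_character_mul_inv_of_isEmpty σ ρ ⟨fun φ => h.false φ.symm⟩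
  -- `F` has squared norm `|G|(d² + m²)`, while its value at `1` alone contributes `(d² + m²)²`.
  let F : G → ℂ := fun g => d * ρ.character g + m * σ.character g
  have hF : ∑ g, Complex.normSq (F g) = (Nat.card G : ℝ) * (d ^ 2 + m ^ 2) := by
    have : ∑ g, (Complex.normSq (F g) : ℂ) = (Nat.card G : ℂ) * (d ^ 2 + m ^ 2) := by
      calc ∑ g, (Complex.normSq (F g) : ℂ)
          = ∑ g, (d ^ 2 * (ρ.character g * ρ.character g⁻¹)
              + m ^ 2 * (σ.character g * σ.character g⁻¹)
              + d * m * (ρ.character g * σ.character g⁻¹)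
              + d * m * (σ.character g * ρ.character g⁻¹)) := by
            refine Finset.sum_congr rfl fun g _ => ?_
            rw [← Complex.mul_conj]
            simp only [F, map_add, map_mul, ← character_inv_eq_conj, Complex.conj_natCast]
            ring
        _ = _ := by
            simp only [Finset.sum_add_distrib, ← Finset.mul_sum, h12, h21,
              sum_character_mul_inv_self]
            ring
    exact_mod_cast this
  have h1 : Complex.normSq (F 1) ≤ ∑ g, Complex.normSq (F g) :=
    Finset.single_le_sum (f := fun g => Complex.normSq (F g))
      (fun g _ => Complex.normSq_nonneg _) (Finset.mem_univ 1)
  have hF1 : F 1 = ((d ^ 2 + m ^ 2 : ℝ) : ℂ) := by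
    simp only [F, char_one, ← hd, ← hm]; push_cast; ring
  rw [hF, hF1, Complex.normSq_ofReal] at h1
  by_contra! hlt
  have hlt' : (Nat.card G : ℝ) < d ^ 2 + m ^ 2 := by exact_mod_cast hlt
  have : (0 : ℝ) < d ^ 2 + m ^ 2 := lt_of_le_of_lt (by positivity) hlt'
  nlinarith

/-- If `ρ` is irreducible with `d (d + e) = |G|`, then every element at which the character
of `ρ` does not vanish acts trivially on all representations of small degree. -/
theorem Representation.eq_one_of_character_ne_zero {G V W : Type*} [Group G] [Finite G]
    [AddCommGroup V] [Module ℂ V] [FiniteDimensional ℂ V] (ρ : Representation ℂ G V)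
    [AddCommGroup W] [Module ℂ W] [FiniteDimensional ℂ W] (σ : Representation ℂ G W)
    [ρ.IsIrreducible] {d e : ℕ} (hd : Module.finrank ℂ V = d) (hn : d * (d + e) = Nat.card G)
    (hm : 2 * e * Module.finrank ℂ W < d + e) {g : G} (hg : ρ.character g ≠ 0) : σ g = 1 := by
  classical
  have := Fintype.ofFinite G
  set m := Module.finrank ℂ W with hm'
  have hnpos : 0 < Nat.card G := Nat.card_pos
  have h0 : (Nat.card G : ℂ) ≠ 0 := by exact_mod_cast hnpos.ne'
  have := invertibleOfNonzero h0
  have hn' : (d * (d + e) : ℝ) = Nat.card G := by exact_mod_cast hn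
  have hm2 : (2 * e * m : ℝ) + 1 ≤ d + e := by exact_mod_cast hm
  let a : G → ℝ := fun g => Complex.normSq (ρ.character g)
  let b : G → ℝ := fun g => (σ.character g).re
  have ha : ∀ g, 0 ≤ a g := fun g => Complex.normSq_nonneg _
  have hb : ∀ g, b g ≤ m := fun g => (abs_le.1 (σ.abs_re_character_le g)).2
  have hb' : ∀ g, -m ≤ b g := fun g => (abs_le.1 (σ.abs_re_character_le g)).1
  have hsa : ∑ g, a g = Nat.card G := ρ.sum_normSq_character
  -- `k` is the dimension of the invariants of `End(V) ⊗ W`; its integrality drives the argument.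
  have hsab : ∃ k : ℕ, ∑ g, a g * b g = Nat.card G * k := by
    have h := card_inv_mul_sum_char_eq_finrank ((linHom ρ ρ).tprod σ)
    rw [inv_mul_eq_iff_eq_mul₀ h0] at h
    refine ⟨Module.finrank ℂ ((linHom ρ ρ).tprod σ).invariants, ?_⟩
    · have h' := congrArg Complex.re h
      rw [← Complex.ofReal_natCast, ← Complex.ofReal_natCast, ← Complex.ofReal_mul,
        Complex.ofReal_re, Complex.re_sum] at h'
      rw [← h']
      refine Finset.sum_congr rfl fun g _ => ?_
      rw [char_tensor, Pi.mul_apply, char_linHom, mul_comm (ρ.character g⁻¹),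
        character_mul_inv_eq_normSq, Complex.re_ofReal_mul]
  obtain ⟨k, hk⟩ := hsab
  have hs : ∑ g, a g * (m - b g) = Nat.card G * (m - k) := by
    simp only [mul_sub, Finset.sum_sub_distrib, hk, ← Finset.sum_mul, hsa]
  have hle : ∑ g, a g * (m - b g) ≤ 2 * m * (Nat.card G - d ^ 2) := by
    have ha1 : a 1 = d ^ 2 := by simp [a, hd, Complex.normSq_apply, sq]
    have hb1 : b 1 = m := by simp [b, ← hm']
    rw [← hsa, ← ha1, ← Finset.add_sum_erase _ a (Finset.mem_univ 1),
      ← Finset.add_sum_erase _ (fun g => a g * (m - b g)) (Finset.mem_univ 1), hb1,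
      add_sub_cancel_left, sub_self, mul_zero, zero_add, Finset.mul_sum]
    refine Finset.sum_le_sum fun g _ => ?_
    nlinarith [ha g, hb' g]
  have hdpos : (0 : ℝ) < d := by
    rcases Nat.eq_zero_or_pos d with h | h
    · rw [h, zero_mul] at hn; omega
    · exact_mod_cast h
  -- By `hle`, `|G|(m - k) ≤ 2m(|G| - d²) = 2mde < d(d + e) = |G|`.
  have hmk : m ≤ k := by
    by_contra! hlt
    have hlt' : (k : ℝ) + 1 ≤ m := by exact_mod_cast hlt
    rw [hs, ← hn'] at hle
    have : (d * (d + e) : ℝ) * 1 ≤ d * (d + e) * (m - k) := by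
      refine mul_le_mul_of_nonneg_left (by linarith) (by positivity)
    nlinarith
  have hz : ∑ g, a g * (m - b g) = 0 := by
    refine le_antisymm ?_ (Finset.sum_nonneg fun g _ => mul_nonneg (ha g) (by linarith [hb g]))
    rw [hs]
    have : (m : ℝ) ≤ k := by exact_mod_cast hmk
    nlinarith [(by positivity : (0 : ℝ) ≤ Nat.card G)]
  have hz' := (Finset.sum_eq_zero_iff_of_nonneg
    (fun g _ => mul_nonneg (ha g) (by linarith [hb g]))).1 hz g (Finset.mem_univ g)
  refine σ.eq_one_of_re_character_eq g ?_
  rcases mul_eq_zero.1 hz' with h | h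
  · exact absurd (Complex.normSq_eq_zero.1 h) hg
  · simp only [b] at h; linarith

/-! ### Schur's lemma and completeness of the irreducible characters -/

theorem Representation.IsIrreducible.finiteDimensional {G V : Type*} [Group G] [Finite G]
    [AddCommGroup V] [Module ℂ V] (ρ : Representation ℂ G V) [ρ.IsIrreducible] :
    FiniteDimensional ℂ V := by
  have : IsSimpleModule (MonoidAlgebra ℂ G) ρ.asModule := inferInstance
  have := IsSimpleModule.nontrivial (MonoidAlgebra ℂ G) ρ.asModule
  obtain ⟨v, hv⟩ := exists_ne (0 : ρ.asModule)
  have hs := IsSimpleModule.toSpanSingleton_surjective (MonoidAlgebra ℂ G) hv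
  let f : MonoidAlgebra ℂ G →ₗ[ℂ] ρ.asModule :=
    (LinearMap.toSpanSingleton (MonoidAlgebra ℂ G) ρ.asModule v).restrictScalars ℂ
  have : Module.Finite ℂ ρ.asModule := Module.Finite.of_surjective f hs
  exact Module.Finite.equiv ρ.asModuleEquiv

theorem Representation.finrank_pos_of_isIrreducible {G V : Type*} [Group G] [Finite G]
    [AddCommGroup V] [Module ℂ V] (ρ : Representation ℂ G V) [ρ.IsIrreducible] :
    0 < Module.finrank ℂ V := by
  have := IsSimpleModule.nontrivial (MonoidAlgebra ℂ G) ρ.asModule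
  have : Nontrivial V := this
  have := IsIrreducible.finiteDimensional ρ
  exact Module.finrank_pos

/-- **Schur's lemma** for class functions. -/
theorem Representation.exists_sum_smul_eq_smul_one {G V : Type*} [Group G] [Fintype G]
    [AddCommGroup V] [Module ℂ V] (ρ : Representation ℂ G V)
    [ρ.IsIrreducible] (f : G → ℂ) (hf : ∀ g h, f (h * g * h⁻¹) = f g) :
    ∃ c : ℂ, ∑ g, f g • ρ g = c • (1 : V →ₗ[ℂ] V) := by
  have := IsIrreducible.finiteDimensional ρ
  have hcomm : ∀ h : G, (∑ g, f g • ρ g) ∘ₗ ρ h = ρ h ∘ₗ ∑ g, f g • ρ g := by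
    intro h
    change (∑ g, f g • ρ g) * ρ h = ρ h * ∑ g, f g • ρ g
    rw [Finset.sum_mul, Finset.mul_sum, ← Equiv.sum_comp (MulAut.conj h).toEquiv]
    refine Finset.sum_congr rfl fun g _ => ?_
    simp [hf, ← map_mul]
  let T : IntertwiningMap ρ ρ := ⟨∑ g, f g • ρ g, hcomm⟩
  obtain ⟨c, hc⟩ := (IsIrreducible.algebraMap_intertwiningMap_bijective_of_isAlgClosed (ρ := ρ)).2 T
  refine ⟨c, ?_⟩
  change T.toLinearMap = _
  rw [← hc]; rfl

theorem Representation.sum_smul_eq_zero {G V : Type*} [Group G] [Fintype G]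
    [AddCommGroup V] [Module ℂ V] (ρ : Representation ℂ G V)
    [ρ.IsIrreducible] (f : G → ℂ) (hf : ∀ g h, f (h * g * h⁻¹) = f g)
    (h0 : ∑ g, f g * ρ.character g = 0) : ∑ g, f g • ρ g = 0 := by
  have := IsIrreducible.finiteDimensional ρ
  obtain ⟨c, hT⟩ := ρ.exists_sum_smul_eq_smul_one f hf
  have hV : (Module.finrank ℂ V : ℂ) ≠ 0 := by exact_mod_cast ρ.finrank_pos_of_isIrreducible.ne'
  have htr := congrArg (LinearMap.trace ℂ V) hT
  rw [map_sum, map_smul, LinearMap.trace_one] at htr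
  simp only [map_smul, smul_eq_mul] at htr
  rw [show ∑ g, f g * LinearMap.trace ℂ V (ρ g) = 0 from h0] at htr
  rw [hT, (mul_eq_zero.1 htr.symm).resolve_right hV, zero_smul]

theorem Representation.asAlgebraHom_ofModule' {k G M : Type*} [Field k] [Group G]
    [AddCommGroup M] [Module k M] [Module (MonoidAlgebra k G) M]
    [IsScalarTower k (MonoidAlgebra k G) M] :
    (ofModule' (k := k) (G := G) M).asAlgebraHom = Algebra.lsmul k k M :=
  (MonoidAlgebra.lift k (M →ₗ[k] M) G).apply_symm_apply _

theorem Submodule.isIrreducible_ofModule' {k G M : Type*} [Field k] [Group G]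
    [AddCommGroup M] [Module k M] [Module (MonoidAlgebra k G) M]
    [IsScalarTower k (MonoidAlgebra k G) M] (S : Submodule (MonoidAlgebra k G) M)
    [IsSimpleModule (MonoidAlgebra k G) S] :
    (Representation.ofModule' (k := k) (G := G) S).IsIrreducible := by
  rw [Representation.irreducible_iff_isSimpleModule_asModule]
  let φ : (Representation.ofModule' (k := k) (G := G) S).asModule ≃ₗ[MonoidAlgebra k G] S :=
    { (Representation.ofModule' (k := k) (G := G) S).asModuleEquiv with
      map_smul' := fun r x => by
        change (Representation.ofModule' (k := k) (G := G) S).asModuleEquiv (r • x) = _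
        rw [Representation.asModuleEquiv_map_smul, Representation.asAlgebraHom_ofModule']
        rfl }
  exact IsSimpleModule.congr φ

/-- The irreducible characters of a finite group separate class functions. -/
theorem Representation.class_function_eq_zero {G : Type u} [Group G] [Fintype G]
    (f : G → ℂ) (hf : ∀ g h, f (h * g * h⁻¹) = f g)
    (h0 : ∀ (W : Type u) [AddCommGroup W] [Module ℂ W] [FiniteDimensional ℂ W]
      (σ : Representation ℂ G W), σ.IsIrreducible → ∑ g, f g * σ.character g = 0) : f = 0 := by
  -- By Schur, `c` kills every simple left ideal. These span the semisimple algebra `ℂ[G]`, so `c =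
  -- c * 1 = 0`.
  let c : MonoidAlgebra ℂ G := ∑ g, MonoidAlgebra.single g (f g)
  have key : ∀ x : MonoidAlgebra ℂ G, c * x = 0 := by
    have hc : ∀ S : Submodule (MonoidAlgebra ℂ G) (MonoidAlgebra ℂ G),
        IsSimpleModule (MonoidAlgebra ℂ G) S → ∀ x ∈ S, c * x = 0 := by
      intro S hS x hx
      have hirr := S.isIrreducible_ofModule'
      have hfd := IsIrreducible.finiteDimensional (ofModule' (k := ℂ) (G := G) S)
      have hz := (ofModule' (k := ℂ) (G := G) S).sum_smul_eq_zero f hf (h0 _ _ hirr)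
      have h1 : (ofModule' (k := ℂ) (G := G) S).asAlgebraHom c = 0 := by
        rw [← hz]; simp [c, asAlgebraHom_single]
      rw [asAlgebraHom_ofModule'] at h1
      exact congrArg Subtype.val (LinearMap.congr_fun h1 ⟨x, hx⟩)
    intro x
    have hx : x ∈ sSup {m : Submodule (MonoidAlgebra ℂ G) (MonoidAlgebra ℂ G) |
        IsSimpleModule (MonoidAlgebra ℂ G) m} := by
      rw [IsSemisimpleModule.sSup_simples_eq_top]; trivial
    rw [sSup_eq_iSup'] at hx
    refine Submodule.iSup_induction _ (motive := fun x => c * x = 0) hx ?_ (mul_zero c) ?_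
    · exact fun S x hx => hc S.1 S.2 x hx
    · intro x y hx hy; rw [mul_add, hx, hy, add_zero]
  have hc0 := key 1
  rw [mul_one] at hc0
  funext g
  have := congrArg (fun a : MonoidAlgebra ℂ G => a.coeff g) hc0
  classical
  simpa [c, MonoidAlgebra.coeff_sum, Finsupp.finsetSum_apply, Finsupp.single_apply] using this

/-- Two elements at which all irreducible characters agree are conjugate. -/
theorem Representation.isConj_of_character_eq {G : Type u} [Group G] [Finite G] {a b : G}
    (hab : ∀ (W : Type u) [AddCommGroup W] [Module ℂ W] [FiniteDimensional ℂ W]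
      (σ : Representation ℂ G W), σ.IsIrreducible → σ.character a = σ.character b) :
    IsConj a b := by
  classical
  have := Fintype.ofFinite G
  -- `F x` is `|C(x)|` times the indicator of the class of `x`.
  let F : G → G → ℂ := fun x g => ∑ t : G, if t * x * t⁻¹ = g then 1 else 0
  have hF : ∀ x g h, F x (h * g * h⁻¹) = F x g := by
    intro x g h
    simp only [F]
    rw [← Equiv.sum_comp (Equiv.mulLeft h)]
    refine Finset.sum_congr rfl fun t _ => ?_
    congr 1
    simp only [Equiv.coe_mulLeft, mul_inv_rev, eq_iff_iff]
    constructor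
    · intro h1; simpa [mul_assoc] using congrArg (fun y => h⁻¹ * y * h) h1
    · rintro rfl; group
  have hsum : ∀ x (W : Type u) [AddCommGroup W] [Module ℂ W] [FiniteDimensional ℂ W]
      (σ : Representation ℂ G W),
      ∑ g, F x g * σ.character g = Nat.card G * σ.character x := by
    intro x W _ _ _ σ
    simp only [F, Finset.sum_mul]
    rw [Finset.sum_comm]
    simp [Nat.card_eq_fintype_card]
  have h0 := class_function_eq_zero (fun g => F a g - F b g)
    (fun g h => by simp only [hF]) (fun W _ _ _ σ hσ => by
      simp only [sub_mul, Finset.sum_sub_distrib, hsum, hab W σ hσ, sub_self])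
  by_contra hc
  have h1 : F b a = 0 := Finset.sum_eq_zero fun t _ =>
    if_neg fun h => hc (isConj_iff.2 ⟨t, h⟩).symm
  have h2 := congrFun h0 a
  beta_reduce at h2
  rw [h1, sub_zero] at h2
  simp only [Pi.zero_apply, F, Finset.sum_boole, Nat.cast_eq_zero, Finset.card_eq_zero] at h2
  have : (1 : G) ∈ Finset.univ.filter fun t : G => t * a * t⁻¹ = a := by simp
  rw [h2] at this
  simp at this

/-! ### Normal subgroups acting trivially on all other simple modules -/

section

open Representation

theorem Subgroup.sum_ite_mem_eq_card {G : Type*} [Group G] [Fintype G] (N : Subgroup G)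
    [DecidablePred (· ∈ N)] : ∑ g, (if g ∈ N then (1 : ℂ) else 0) = Nat.card N := by
  rw [Finset.sum_boole, Nat.card_eq_fintype_card, Fintype.card_subtype]

theorem Subgroup.eq_bot_of_forall_irreducible {G : Type u} [Group G] [Finite G]
    {N : Subgroup G}
    (h : ∀ (W : Type u) [AddCommGroup W] [Module ℂ W] (σ : Representation ℂ G W),
      σ.IsIrreducible → ∀ g ∈ N, σ g = 1) : N = ⊥ := by
  refine (Subgroup.eq_bot_iff_forall N).2 fun x hx => ?_
  have : IsConj x 1 := isConj_of_character_eq fun W _ _ _ σ hσ => by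
    simp only [character, h W σ hσ x hx, map_one]
  exact isConj_one_left.1 this

theorem Representation.character_eq_of_forall_ne {G : Type u} [Group G] [Finite G]
    {V : Type v} [AddCommGroup V] [Module ℂ V] (ρ : Representation ℂ G V) [ρ.IsIrreducible]
    {a b : G} (hρ : ρ.character a = ρ.character b)
    (h : ∀ (W : Type u) [AddCommGroup W] [Module ℂ W] (σ : Representation ℂ G W),
      σ.IsIrreducible → IsEmpty (Equiv ρ σ) → σ.character a = σ.character b) : IsConj a b := by
  refine isConj_of_character_eq fun W _ _ _ σ hσ => ?_
  rcases isEmpty_or_nonempty (Equiv ρ σ) with hE | ⟨⟨φ⟩⟩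
  · exact h W σ hσ hE
  · rw [← char_iso φ, hρ]

namespace ActsTriviallyOnOtherSimples

variable {G : Type u} [Group G] [Finite G] {V : Type v} [AddCommGroup V] [Module ℂ V]
  {ρ : Representation ℂ G V} {N : Subgroup G}

/-- The sum of `ρ` over `N` is a scalar that absorbs each `ρ x`, `x ∈ N`. If it were nonzero, `N`
would act trivially on every simple module. -/
theorem sum_character_eq_zero [ρ.IsIrreducible] [Fintype G] [DecidablePred (· ∈ N)]
    (h : ActsTriviallyOnOtherSimples N ρ) (hN : N.Normal) (hN1 : N ≠ ⊥) :
    ∑ g, (if g ∈ N then (1 : ℂ) else 0) * ρ.character g = 0 := by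
  have hf : ∀ g h : G, (if h * g * h⁻¹ ∈ N then (1 : ℂ) else 0) = if g ∈ N then 1 else 0 :=
    fun g h => by simp only [← hN.mem_comm_iff (a := h⁻¹), inv_mul_cancel_left]
  obtain ⟨c, hc⟩ := ρ.exists_sum_smul_eq_smul_one
    (fun g => if g ∈ N then (1 : ℂ) else 0) hf
  rcases eq_or_ne c 0 with rfl | hc0
  · have := congrArg (LinearMap.trace ℂ V) hc
    simpa only [map_sum, map_smul, smul_eq_mul, zero_smul, map_zero, character] using this
  · exfalso
    refine hN1 (N.eq_bot_of_forall_irreducible fun W _ _ σ hσ x hx => ?_)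
    rcases isEmpty_or_nonempty (Equiv ρ σ) with hE | ⟨⟨φ⟩⟩
    · exact h W σ hσ hE x hx
    · have hx1 : ρ x * (c • 1) = c • 1 := by
        rw [← hc, Finset.mul_sum, ← Equiv.sum_comp (Equiv.mulLeft x)
          (fun g => (if g ∈ N then (1 : ℂ) else 0) • ρ g)]
        refine Finset.sum_congr rfl fun g _ => ?_
        simp [N.mul_mem_cancel_left hx]
      have hx2 : ρ x = 1 := by
        rw [mul_smul_comm, mul_one] at hx1
        exact smul_right_injective _ hc0 hx1
      rw [← φ.conj_apply_self, hx2]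
      exact LinearMap.ext fun w => φ.right_inv w

/-- The right side is the regular character of `G` minus that of `G/N`, in which only `V` survives.
The proof compares pairings with all irreducible characters. -/
theorem finrank_mul_character [ρ.IsIrreducible] [DecidableEq G] [DecidablePred (· ∈ N)]
    (h : ActsTriviallyOnOtherSimples N ρ) (hN : N.Normal) (hN1 : N ≠ ⊥) (g : G) :
    Module.finrank ℂ V * ρ.character g = Nat.card G *
      ((if g = 1 then 1 else 0) - (Nat.card N : ℂ)⁻¹ * if g ∈ N then 1 else 0) := by
  have := Fintype.ofFinite G
  have := IsIrreducible.finiteDimensional ρ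
  have hq : (Nat.card N : ℂ) ≠ 0 := by exact_mod_cast Nat.card_pos.ne'
  have hf : ∀ g h : G, (if h * g * h⁻¹ ∈ N then (1 : ℂ) else 0) = if g ∈ N then 1 else 0 :=
    fun g h => by simp only [← hN.mem_comm_iff (a := h⁻¹), inv_mul_cancel_left]
  have key := class_function_eq_zero (fun g => Module.finrank ℂ V * ρ.character g⁻¹ - Nat.card G *
      ((if g = 1 then 1 else 0) - (Nat.card N : ℂ)⁻¹ * if g ∈ N then 1 else 0))
    (fun g h => by
      simp only [hf, conj_eq_one_iff]
      rw [conj_inv, char_conj]) (fun W _ _ _ σ hσ => by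
      have hsplit : ∑ g, (Module.finrank ℂ V * ρ.character g⁻¹ - Nat.card G *
          ((if g = 1 then 1 else 0) - (Nat.card N : ℂ)⁻¹ * if g ∈ N then 1 else 0))
            * σ.character g
          = Module.finrank ℂ V * ∑ g, σ.character g * ρ.character g⁻¹
            - Nat.card G * (Module.finrank ℂ W - (Nat.card N : ℂ)⁻¹ *
              ∑ g, (if g ∈ N then (1 : ℂ) else 0) * σ.character g) := by
        have h1 : (Module.finrank ℂ W : ℂ) = ∑ g, (if g = 1 then 1 else 0) * σ.character g := by
          simp
        rw [h1, Finset.mul_sum, Finset.mul_sum, ← Finset.sum_sub_distrib, Finset.mul_sum,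
          ← Finset.sum_sub_distrib]
        refine Finset.sum_congr rfl fun g _ => ?_
        ring
      rw [hsplit]
      rcases isEmpty_or_nonempty (Equiv ρ σ) with hE | ⟨⟨φ⟩⟩
      · rw [sum_character_mul_inv_of_isEmpty ρ σ hE]
        have : ∑ g, (if g ∈ N then (1 : ℂ) else 0) * σ.character g
            = Nat.card N * Module.finrank ℂ W := by
          rw [← N.sum_ite_mem_eq_card, Finset.sum_mul]
          refine Finset.sum_congr rfl fun g _ => ?_
          split_ifs with hg
          · simp [character, h W σ hσ hE g hg]
          · simp
        rw [this]
        field_simp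
        ring
      · have hd : Module.finrank ℂ W = Module.finrank ℂ V := φ.toLinearEquiv.finrank_eq.symm
        rw [← char_iso φ, sum_character_mul_inv_self, h.sum_character_eq_zero hN hN1, hd]
        ring)
  have h1 := congrFun key g⁻¹
  simp only [inv_inv, inv_eq_one, inv_mem_iff, Pi.zero_apply] at h1
  exact sub_eq_zero.1 h1

/-- The character formula at `1` reads `d²|N| = |G|(|N| - 1)`, whence `d = e(|N| - 1)`. -/
theorem card_eq [ρ.IsIrreducible] (h : ActsTriviallyOnOtherSimples N ρ) (hN : N.Normal)
    (hN1 : N ≠ ⊥) {e : ℕ}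
    (hn : Module.finrank ℂ V * (Module.finrank ℂ V + e) = Nat.card G) :
    Nat.card G = e ^ 2 * Nat.card N * (Nat.card N - 1) := by
  classical
  have := IsIrreducible.finiteDimensional ρ
  set d := Module.finrank ℂ V with hd
  have hdpos : 0 < d := ρ.finrank_pos_of_isIrreducible
  have hq : (Nat.card N : ℂ) ≠ 0 := by exact_mod_cast Nat.card_pos.ne'
  have h1 := h.finrank_mul_character hN hN1 1
  rw [char_one, if_pos rfl, if_pos N.one_mem, ← hd] at h1
  obtain ⟨r, hr⟩ : ∃ r, Nat.card N = r + 1 := ⟨Nat.card N - 1, by have := Nat.card_pos (α := N); omega⟩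
  rw [hr] at h1 hq ⊢
  have h2 : d * d * (r + 1) = d * (d + e) * r := by
    rw [hn]
    have : (d * d * (r + 1 : ℕ) : ℂ) = Nat.card G * r := by
      rw [h1]; field_simp; push_cast; ring
    exact_mod_cast this
  have h3 : d = e * r := by
    have : d * (d * (r + 1)) = d * ((d + e) * r) := by rw [← mul_assoc, h2, mul_assoc]
    have := Nat.eq_of_mul_eq_mul_left hdpos this
    nlinarith
  rw [← hn, h3, Nat.add_sub_cancel]; ring

/-- By the formula, `χ(g)` depends only on whether `g = 1` and whether `g ∈ N`; the other
irreducible characters are constant on cosets of `N`. The same reason gives `isConj_mul`. -/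
theorem isConj_of_mem [ρ.IsIrreducible] (h : ActsTriviallyOnOtherSimples N ρ) (hN : N.Normal)
    (hN1 : N ≠ ⊥) {x y : G} (hx : x ∈ N) (hy : y ∈ N) (hx1 : x ≠ 1) (hy1 : y ≠ 1) :
    IsConj x y := by
  classical
  have hd : (Module.finrank ℂ V : ℂ) ≠ 0 := by exact_mod_cast ρ.finrank_pos_of_isIrreducible.ne'
  refine ρ.character_eq_of_forall_ne (mul_left_cancel₀ hd ?_) fun W _ _ σ hσ hE => ?_
  · rw [h.finrank_mul_character hN hN1, h.finrank_mul_character hN hN1]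
    simp [hx, hy, hx1, hy1]
  · simp only [character, h W σ hσ hE _ hx, h W σ hσ hE _ hy]

theorem isConj_mul [ρ.IsIrreducible] (h : ActsTriviallyOnOtherSimples N ρ) (hN : N.Normal)
    (hN1 : N ≠ ⊥) {g y : G} (hg : g ∉ N) (hy : y ∈ N) : IsConj g (g * y) := by
  classical
  have hd : (Module.finrank ℂ V : ℂ) ≠ 0 := by exact_mod_cast ρ.finrank_pos_of_isIrreducible.ne'
  have hg1 : g ≠ 1 := fun h => hg (h ▸ N.one_mem)
  have hgy : g * y ∉ N := fun h => hg ((N.mul_mem_cancel_right hy).1 h)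
  have hgy1 : g * y ≠ 1 := fun h => hgy (h ▸ N.one_mem)
  refine ρ.character_eq_of_forall_ne (mul_left_cancel₀ hd ?_) fun W _ _ σ hσ hE => ?_
  · rw [h.finrank_mul_character hN hN1, h.finrank_mul_character hN hN1]
    simp only [hg, hg1, hgy, hgy1, if_false]
  · simp only [character, map_mul, h W σ hσ hE _ hy, mul_one]

end ActsTriviallyOnOtherSimples

/-- A simple module of large degree forces a nontrivial normal subgroup that acts trivially on
all other simple modules. -/
theorem Representation.exists_normal_actsTriviallyOnOtherSimples {G : Type u} [Group G] [Finite G]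
    {V : Type v} [AddCommGroup V] [Module ℂ V] (ρ : Representation ℂ G V) [ρ.IsIrreducible]
    {d e : ℕ} (hd : Module.finrank ℂ V = d) (hn : d * (d + e) = Nat.card G) (he : 0 < e)
    (hde : 4 * e ^ 3 ≤ d) :
    ∃ N : Subgroup G, N.Normal ∧ N ≠ ⊥ ∧ ActsTriviallyOnOtherSimples N ρ := by
  have := IsIrreducible.finiteDimensional ρ
  have := Fintype.ofFinite G
  let N : Subgroup G :=
    { carrier := {g | ∀ (W : Type u) [AddCommGroup W] [Module ℂ W] (σ : Representation ℂ G W),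
        σ.IsIrreducible → IsEmpty (Equiv ρ σ) → σ g = 1}
      mul_mem' := fun {a b} ha hb W _ _ σ hσ hE => by
        rw [map_mul, ha W σ hσ hE, hb W σ hσ hE, mul_one]
      one_mem' := fun W _ _ σ _ _ => map_one σ
      inv_mem' := fun {a} ha W _ _ σ hσ hE => by
        have : σ (a⁻¹ * a) = 1 := by rw [inv_mul_cancel, map_one]
        rwa [map_mul, ha W σ hσ hE, mul_one] at this }
  have hNn : N.Normal := ⟨fun a ha g W _ _ σ hσ hE => by
    rw [map_mul, map_mul, ha W σ hσ hE, mul_one, ← map_mul, mul_inv_cancel, map_one]⟩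
  refine ⟨N, hNn, fun hbot => ?_, fun W _ _ σ hσ hE g hg => hg W σ hσ hE⟩
  have hdpos : 0 < d := hd ▸ ρ.finrank_pos_of_isIrreducible
  have hvan : ∀ g : G, g ≠ 1 → ρ.character g = 0 := by
    intro g hg
    by_contra hg0
    refine hg ((Subgroup.eq_bot_iff_forall N).1 hbot g fun W _ _ σ hσ hE => ?_)
    have := IsIrreducible.finiteDimensional σ
    refine ρ.eq_one_of_character_ne_zero σ hd hn ?_ hg0
    have h1 := finrank_sq_add_finrank_sq_le ρ σ hE
    rw [hd, ← hn] at h1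
    set m := Module.finrank ℂ W
    have h2 : m ^ 2 ≤ d * e := by nlinarith
    -- The threshold `4e³ ≤ d` is what makes `(2em)² ≤ 4e³d ≤ d²`.
    refine lt_of_pow_lt_pow_left₀ 2 (by positivity) ?_
    calc (2 * e * m) ^ 2 = 4 * e ^ 2 * m ^ 2 := by ring
      _ ≤ 4 * e ^ 2 * (d * e) := by gcongr
      _ = 4 * e ^ 3 * d := by ring
      _ ≤ d * d := by gcongr
      _ < (d + e) ^ 2 := by nlinarith
  have h1 := ρ.sum_normSq_character
  rw [Finset.sum_eq_single 1 (fun g _ hg => by rw [hvan g hg, map_zero]) (by simp), char_one, hd,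
    ← hn, Complex.normSq_natCast] at h1
  have h2 : d * d = d * (d + e) := by exact_mod_cast h1
  have := Nat.eq_of_mul_eq_mul_left hdpos h2
  omega

end

/-! ### Conjugacy classes, `p`-subgroups and the bound `|N| ≤ e²` -/

theorem Subgroup.card_centralizer_mul_ncard {G : Type*} [Group G] [Finite G] (g : G) :
    Nat.card (centralizer {g}) * {h | IsConj g h}.ncard = Nat.card G := by
  have h1 := (MulAction.stabilizer (ConjAct G) g).card_mul_index
  rw [MulAction.index_stabilizer] at h1
  have h2 : MulAction.orbit (ConjAct G) g = {h | IsConj g h} := by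
    ext h
    rw [ConjAct.mem_orbit_conjAct, isConj_comm]; rfl
  rw [nat_card_centralizer_nat_card_stabilizer, ← h2, h1]
  rfl

open scoped Pointwise in
/-- If the conjugacy class of `g` is a union of cosets of `N`, then `|C(g)| |N|` divides `|G|`. -/
theorem Subgroup.card_centralizer_mul_card_dvd {G : Type*} [Group G] [Finite G] {N : Subgroup G}
    {g : G} (h : ∀ a, IsConj g a → ∀ y ∈ N, IsConj g (a * y)) :
    Nat.card (centralizer {g}) * Nat.card N ∣ Nat.card G := by
  rw [← card_centralizer_mul_ncard g]
  refine mul_dvd_mul_left _ ?_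
  have h1 := card_mul_eq_card_subgroup_mul_card_quotient N {a | IsConj g a}
  have h2 : {a | IsConj g a} * (N : Set G) = {a | IsConj g a} := by
    ext a
    constructor
    · rintro ⟨b, hb, y, hy, rfl⟩
      exact h b hb y hy
    · exact fun ha => ⟨a, ha, 1, N.one_mem, mul_one a⟩
  rw [h2, Nat.card_coe_set_eq] at h1
  exact ⟨_, h1⟩

theorem IsConj.orderOf_eq {G : Type*} [Group G] {a b : G} (h : IsConj a b) :
    orderOf a = orderOf b := by
  obtain ⟨c, rfl⟩ := isConj_iff.1 h
  exact ((MulAut.conj c).orderOf_eq a).symm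

/-- A nontrivial normal subgroup whose nontrivial elements form one conjugacy class is an
elementary abelian `p`-group. -/
theorem Subgroup.Normal.exists_prime_of_isConj {G : Type*} [Group G] [Finite G] {N : Subgroup G}
    (hN : N.Normal) (hN1 : N ≠ ⊥)
    (hc : ∀ x ∈ N, ∀ y ∈ N, x ≠ 1 → y ≠ 1 → IsConj x y) :
    ∃ p : ℕ, p.Prime ∧ (∀ x ∈ N, x ≠ 1 → orderOf x = p) ∧ IsPGroup p N ∧
      ∀ x ∈ N, ∀ y ∈ N, x * y = y * x := by
  have hN2 : Nat.card N ≠ 1 := fun h => hN1 (N.card_eq_one.1 h)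
  obtain ⟨p, hp, hpN⟩ := Nat.exists_prime_and_dvd hN2
  have := Fact.mk hp
  obtain ⟨z, hz⟩ := exists_prime_orderOf_dvd_card' p hpN
  have hz' : orderOf (z : G) = p := by rw [Subgroup.orderOf_coe, hz]
  have hz1 : (z : G) ≠ 1 := fun h => by rw [h, orderOf_one] at hz'; exact hp.one_lt.ne hz'
  have hord : ∀ x ∈ N, x ≠ 1 → orderOf x = p := fun x hx hx1 =>
    ((hc x hx z z.2 hx1 hz1).orderOf_eq).trans hz'
  have hpg : IsPGroup p N := by
    rw [IsPGroup.iff_orderOf]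
    intro g
    rcases eq_or_ne (g : G) 1 with h | h
    · exact ⟨0, by rw [← Subgroup.orderOf_coe, h, orderOf_one, pow_zero]⟩
    · exact ⟨1, by rw [← Subgroup.orderOf_coe, hord g g.2 h, pow_one]⟩
  refine ⟨p, hp, hord, hpg, fun x hx y hy => ?_⟩
  rcases eq_or_ne x 1 with rfl | hx1
  · simp
  have : Nontrivial N := (Subgroup.nontrivial_iff_ne_bot N).2 hN1
  have := hpg.center_nontrivial
  obtain ⟨w, hw⟩ := exists_ne (1 : center N)
  have hw1 : ((w : N) : G) ≠ 1 := fun h => hw (Subtype.ext (Subtype.ext h))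
  -- `x` is conjugate to the central element `w` of `N`, and conjugation preserves `N`, so `x` is
  -- central too.
  obtain ⟨c, rfl⟩ := isConj_iff.1 (hc _ w.1.2 x hx hw1 hx1)
  have hcy : c⁻¹ * y * c ∈ N := by simpa using hN.conj_mem y hy c⁻¹
  have h1 := congrArg Subtype.val (Subgroup.mem_center_iff.1 w.2 ⟨_, hcy⟩)
  simp only [Subgroup.coe_mul] at h1
  have h2 := congrArg (fun a => c * a * c⁻¹) h1
  simp only [mul_assoc, mul_inv_cancel_left] at h2
  simpa [mul_assoc] using h2.symm

/-- A `p`-subgroup centralizes a nontrivial element of every nontrivial normal `p`-subgroup. -/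
theorem IsPGroup.exists_ne_one_commute {G : Type*} [Group G] [Finite G] {p : ℕ} [Fact p.Prime]
    {N P : Subgroup G} [hN : N.Normal] (hpN : IsPGroup p N) (hN1 : N ≠ ⊥) (hP : IsPGroup p P) :
    ∃ y ∈ N, y ≠ 1 ∧ ∀ g ∈ P, g * y * g⁻¹ = y := by
  let _ : MulAction P N := MulAction.compHom N ((MulAut.conjNormal (H := N)).comp P.subtype)
  have hsmul : ∀ (g : P) (y : N), ((g • y : N) : G) = g * y * (g : G)⁻¹ := fun g y => rfl
  have h1 : (1 : N) ∈ MulAction.fixedPoints P N := fun g => Subtype.ext (by simp [hsmul])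
  have hdvd : p ∣ Nat.card N :=
    (hpN.card_eq_or_dvd).resolve_left fun h => hN1 (N.card_eq_one.1 h)
  obtain ⟨b, hb, hb1⟩ := hP.exists_fixed_point_of_prime_dvd_card_of_fixed_point N hdvd h1
  exact ⟨b, b.2, fun h => hb1 (Subtype.ext h.symm), fun g hg =>
    congrArg Subtype.val (hb ⟨g, hg⟩)⟩

theorem Subgroup.mem_centralizer_singleton_of_conj {G : Type*} [Group G] {g y : G}
    (h : g * y * g⁻¹ = y) : y ∈ centralizer {g} := by
  rw [mem_centralizer_singleton_iff]
  exact (mul_inv_eq_iff_eq_mul.1 h).symm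

/-- Let `N` be a nontrivial normal `p`-subgroup of `G`, with `p` odd, such that the nontrivial
elements of `N` have `p`-groups as centralizers and every coset of `N` other than `N` lies in one
conjugacy class. If `|G| = p ^ b * (p ^ k - 1) * p ^ k` with `b > 0` and `|N| = p ^ k`, then `N` is
properly contained in its centralizer. -/
theorem Subgroup.Normal.exists_notMem_forall_commute {G : Type*} [Group G] [Finite G]
    {N : Subgroup G} (hN : N.Normal) (hN1 : N ≠ ⊥) {p : ℕ} (hp : p.Prime) (hp2 : p ≠ 2)
    (hord : ∀ x ∈ N, x ≠ 1 → orderOf x = p) (hpN : IsPGroup p N)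
    (hcomm : ∀ x ∈ N, ∀ y ∈ N, x * y = y * x)
    (hcent : ∀ x ∈ N, x ≠ 1 → IsPGroup p (centralizer {x})) {b : ℕ} (hb : b ≠ 0)
    (hcard : Nat.card G = p ^ b * (Nat.card N - 1) * Nat.card N)
    (hdvd : ∀ g ∉ N, ∀ P : Subgroup G, IsPGroup p P → P ≤ centralizer {g} →
      Nat.card P ∣ p ^ b) :
    ∃ g ∉ N, ∀ y ∈ N, g * y = y * g := by
  have := Fact.mk hp
  by_contra! hself
  replace hself : ∀ g, (∀ y ∈ N, g * y * g⁻¹ = y) → g ∈ N := by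
    intro g hg
    by_contra hgN
    obtain ⟨y, hy, hne⟩ := hself g hgN
    exact hne (mul_inv_eq_iff_eq_mul.1 (hg y hy))
  obtain ⟨k, hk⟩ := IsPGroup.iff_card.1 hpN
  have hpodd : Odd p := hp.odd_of_ne_two hp2
  have h2 : 2 ∣ Nat.card G := by
    rw [hcard, hk]
    have : 2 ∣ p ^ k - 1 := (Nat.Odd.sub_odd (hpodd.pow) odd_one).two_dvd
    exact (this.mul_left _).mul_right _
  obtain ⟨t, ht⟩ := exists_prime_orderOf_dvd_card' 2 h2
  have htt : t * t = 1 := by rw [← sq, ← ht, pow_orderOf_eq_one]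
  have htinv : t⁻¹ = t := inv_eq_of_mul_eq_one_left htt
  -- Centralizers of nontrivial elements of `N` have odd order, so `t` acts on `N` without
  -- nontrivial fixed points. As `y · tyt⁻¹` is fixed, `t` inverts `N`.
  have hfix : ∀ u ∈ N, t * u * t⁻¹ = u → u = 1 := by
    intro u hu htu
    by_contra hu1
    have htc : t ∈ centralizer {u} := by
      rw [mem_centralizer_singleton_iff]
      exact mul_inv_eq_iff_eq_mul.1 htu
    obtain ⟨j, hj⟩ := IsPGroup.iff_orderOf.1 (hcent u hu hu1) ⟨t, htc⟩
    rw [← Subgroup.orderOf_coe, ht] at hj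
    have : Odd 2 := hj ▸ hpodd.pow
    exact absurd this (by decide)
  have hinv : ∀ y ∈ N, t * y * t⁻¹ = y⁻¹ := by
    intro y hy
    have hy' := hN.conj_mem y hy t
    have := hfix _ (N.mul_mem hy hy') (by
      have h1 : t * (y * (t * y * t⁻¹)) * t⁻¹ = t * y * t⁻¹ * (t * t) * y * (t * t)⁻¹ := by group
      rw [h1, htt, inv_one, mul_one, mul_one]
      exact hcomm _ hy' _ hy)
    exact (inv_eq_of_mul_eq_one_right this).symm
  -- Both `t` and `hth⁻¹` invert `N`, so `w = hth⁻¹t⁻¹` centralizes `N` and lies in it. As `p = 2r +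
  -- 1`, `z = w ^ (r + 1)` is a square root of `w`, and `ztz⁻¹ = wt = hth⁻¹`.
  have hsplit : ∀ h : G, ∃ z ∈ N, z⁻¹ * h ∈ centralizer {t} := by
    intro h
    have hw : h * t * h⁻¹ * t⁻¹ ∈ N := by
      refine hself _ fun y hy => ?_
      have hy1 := hN.conj_mem y⁻¹ (N.inv_mem hy) h⁻¹
      calc h * t * h⁻¹ * t⁻¹ * y * (h * t * h⁻¹ * t⁻¹)⁻¹
          = h * (t * (h⁻¹ * (t * y * t⁻¹) * h) * t⁻¹) * h⁻¹ := by rw [htinv]; simp [mul_assoc, htinv]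
        _ = y := by
          rw [hinv y hy]
          rw [inv_inv] at hy1
          rw [hinv _ hy1]; simp [mul_assoc]
    set w := h * t * h⁻¹ * t⁻¹ with hwdef
    obtain ⟨r, hr⟩ := hpodd
    have hwp : w ^ p = 1 := by
      rcases eq_or_ne w 1 with h1 | h1
      · rw [h1, one_pow]
      · rw [← hord w hw h1, pow_orderOf_eq_one]
    refine ⟨w ^ (r + 1), N.pow_mem hw _, ?_⟩
    set z := w ^ (r + 1) with hz
    have hzz : z * z = w := by
      rw [hz, ← pow_add, show r + 1 + (r + 1) = p + 1 by omega, pow_succ, hwp, one_mul]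
    have hzN : z ∈ N := N.pow_mem hw _
    have h1 : z * t * z⁻¹ = h * t * h⁻¹ := by
      have h3 := hinv z⁻¹ (N.inv_mem hzN)
      rw [inv_inv] at h3
      calc z * t * z⁻¹ = z * (t * z⁻¹ * t⁻¹) * t := by group
        _ = w * t := by rw [h3, hzz]
        _ = h * t * h⁻¹ := by rw [hwdef]; group
    rw [mem_centralizer_singleton_iff]
    have h4 := congrArg (fun a => z⁻¹ * a * h) h1
    simp only [mul_assoc, inv_mul_cancel_left, inv_mul_cancel, mul_one] at h4
    simp only [mul_assoc, h4]
  have hdisj : Disjoint N (centralizer {t}) := by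
    rw [disjoint_iff_inf_le]
    rintro u ⟨hu, hut⟩
    refine mem_bot.2 (hfix u hu ?_)
    rw [mul_inv_eq_iff_eq_mul]
    exact (mem_centralizer_singleton_iff.1 hut).symm
  have hcompl : IsComplement' N (centralizer {t}) :=
    isComplement'_of_disjoint_and_mul_eq_univ hdisj (Set.eq_univ_of_forall fun h => by
      obtain ⟨z, hz, hzh⟩ := hsplit h
      exact ⟨z, hz, _, hzh, by simp⟩)
  have hC : p ^ b ∣ Nat.card (centralizer {t}) := by
    have h1 := hcompl.card_mul_card
    rw [hcard, mul_comm] at h1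
    have h3 := Nat.eq_of_mul_eq_mul_right Nat.card_pos h1
    exact ⟨_, h3⟩
  obtain ⟨K, hK⟩ := Sylow.exists_subgroup_card_pow_prime p hC
  set P := K.map (centralizer {t}).subtype with hPdef
  have hPt : P ≤ centralizer {t} := map_subtype_le K
  have hPcard : Nat.card P = p ^ b := by
    rw [hPdef, card_map_of_injective (subtype_injective _), hK]
  have hPp : IsPGroup p P := IsPGroup.of_card hPcard
  have hPnt : Nontrivial P := by
    rw [Subgroup.nontrivial_iff_ne_bot, Ne, ← Subgroup.card_eq_one, hPcard]
    exact (Nat.one_lt_pow hb hp.one_lt).ne'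
  have := hPp.center_nontrivial
  obtain ⟨c, hc⟩ := exists_ne (1 : center P)
  set g : G := ((c : P) : G) with hg
  have hg1 : g ≠ 1 := fun h => hc (Subtype.ext (Subtype.ext h))
  have hgP : g ∈ P := (c : P).2
  have hgN : g ∉ N := fun h => hg1 (mem_bot.1 (hdisj.le_bot ⟨h, hPt hgP⟩))
  have hPg : P ≤ centralizer {g} := by
    intro x hx
    rw [mem_centralizer_singleton_iff]
    exact congrArg Subtype.val (mem_center_iff.1 c.2 ⟨x, hx⟩)
  obtain ⟨y, hyN, hy1, hyP⟩ := hpN.exists_ne_one_commute hN1 hPp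
  -- `P` has the largest order allowed for a `p`-subgroup of `C(g)`, so the `p`-group `MP` equals
  -- `P`. Then `y ∈ P ∩ N`, which is trivial because `P ≤ C(t)`.
  let M := N ⊓ centralizer {g}
  have hyM : y ∈ M := ⟨hyN, mem_centralizer_singleton_of_conj (hyP g hgP)⟩
  have hMp : IsPGroup p M := hpN.to_inf_left
  have hnorm : P ≤ normalizer M := by
    intro x hx
    rw [mem_normalizer_iff]
    intro u
    have hxg := hPg hx
    constructor
    · rintro ⟨hu, hug⟩
      exact ⟨hN.conj_mem u hu x, Subgroup.mul_mem _ (Subgroup.mul_mem _ hxg hug) (Subgroup.inv_mem _ hxg)⟩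
    · rintro ⟨hu, hug⟩
      have h1 := hN.conj_mem _ hu x⁻¹
      have h3 := Subgroup.mul_mem _ (Subgroup.mul_mem _ (Subgroup.inv_mem _ hxg) hug) hxg
      exact ⟨by simpa [mul_assoc] using h1, by simpa [mul_assoc] using h3⟩
  have hsup : IsPGroup p (M ⊔ P : Subgroup G) := hMp.to_sup_of_normal_left' hPp hnorm
  have hle := Nat.le_of_dvd (pow_pos hp.pos b) (hdvd g hgN _ hsup (sup_le inf_le_right hPg))
  have heq := Subgroup.eq_of_le_of_card_ge (le_sup_right : P ≤ M ⊔ P) (hPcard.symm ▸ hle)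
  have hyP' : y ∈ P := heq ▸ (le_sup_left : M ≤ M ⊔ P) hyM
  exact hy1 (mem_bot.1 (hdisj.le_bot ⟨hyN, hPt hyP'⟩))

/-- Let `N` be a nontrivial normal subgroup of `G` such that the nontrivial elements of `N` form
one conjugacy class and every other coset of `N` lies in one conjugacy class. If
`|G| = e² |N| (|N| - 1)` where `e > 1` is not a power of `2`, then `|N| ≤ e²`. -/
theorem Subgroup.Normal.card_le_sq {G : Type*} [Group G] [Finite G] {N : Subgroup G}
    (hN : N.Normal) (hN1 : N ≠ ⊥)
    (hconj : ∀ x ∈ N, ∀ y ∈ N, x ≠ 1 → y ≠ 1 → IsConj x y)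
    (hcoset : ∀ g ∉ N, ∀ y ∈ N, IsConj g (g * y)) {e : ℕ} (he : 1 < e)
    (he2 : ¬ ∃ m : ℕ, e = 2 ^ m)
    (hcard : Nat.card G = e ^ 2 * Nat.card N * (Nat.card N - 1)) : Nat.card N ≤ e ^ 2 := by
  obtain ⟨p, hp, hord, hpN, hcomm⟩ := hN.exists_prime_of_isConj hN1 hconj
  have := Fact.mk hp
  obtain ⟨k, hk⟩ := IsPGroup.iff_card.1 hpN
  have hq1 : 1 < Nat.card N := (Subgroup.one_lt_card_iff_ne_bot N).2 hN1
  have hk0 : k ≠ 0 := fun h => by rw [hk, h, pow_zero] at hq1; exact lt_irrefl _ hq1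
  have hcop : Nat.Coprime p (Nat.card N - 1) := by
    rw [hp.coprime_iff_not_dvd]
    intro h
    have h1 : p ∣ Nat.card N := hk ▸ dvd_pow_self p hk0
    have h3 := (Nat.dvd_sub h1 h)
    rw [Nat.sub_sub_self hq1.le] at h3
    exact hp.one_lt.ne' (Nat.dvd_one.1 h3)
  have hcent : ∀ x ∈ N, x ≠ 1 → IsPGroup p (centralizer {x}) := by
    intro x hx hx1
    refine IsPGroup.of_card (Nat.eq_prime_pow_of_unique_prime_dvd Nat.card_pos.ne' ?_)
    -- If `g` of prime order `r ≠ p` commuted with `x`, then `gx`, conjugate to `g`, would have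
    -- order `r`, forcing `x ^ r = 1`.
    intro r hr hrd
    have := Fact.mk hr
    by_contra hrp
    obtain ⟨⟨g, hgx⟩, hgr⟩ := exists_prime_orderOf_dvd_card' r hrd
    rw [← Subgroup.orderOf_coe] at hgr
    change orderOf g = r at hgr
    have hg1 : g ≠ 1 := fun h => by rw [h, orderOf_one] at hgr; exact hr.one_lt.ne hgr
    have hgN : g ∉ N := fun h => hrp (hgr.symm.trans (hord g h hg1))
    have h1 := (hcoset g hgN x hx).orderOf_eq
    have hcom : Commute g x := mem_centralizer_singleton_iff.1 hgx
    have h3 : x ^ r = 1 := by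
      have h4 : (g * x) ^ r = 1 := by rw [← hgr, h1, pow_orderOf_eq_one]
      rwa [hcom.mul_pow, ← hgr, pow_orderOf_eq_one, one_mul, hgr] at h4
    have h4 := orderOf_dvd_of_pow_eq_one h3
    rw [hord x hx hx1] at h4
    exact hrp ((Nat.prime_dvd_prime_iff_eq hp hr).1 h4).symm
  -- The class of `x` is `N \ {1}`, so `|C(x)| = e²|N|`, which is a power of `p`.
  obtain ⟨a, ha⟩ : ∃ a, e = p ^ a := by
    obtain ⟨⟨x, hx⟩, hne⟩ := N.ne_bot_iff_exists_ne_one.1 hN1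
    have hx1 : x ≠ 1 := fun h => hne (Subtype.ext h)
    have h1 := card_centralizer_mul_ncard x
    have h3 : {h | IsConj x h} = (N : Set G) \ {1} := by
      ext h
      constructor
      · intro hh
        obtain ⟨c, rfl⟩ := isConj_iff.1 hh
        exact ⟨hN.conj_mem _ hx c, fun hh => hx1 (conj_eq_one_iff.1 hh)⟩
      · rintro ⟨hh, hh1⟩
        exact hconj _ hx h hh hx1 hh1
    rw [h3, Set.ncard_sdiff_singleton_of_mem N.one_mem, ← Nat.card_coe_set_eq, hcard] at h1
    have h4 := Nat.eq_of_mul_eq_mul_right (by simpa using hq1) h1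
    obtain ⟨m, hm⟩ := IsPGroup.iff_card.1 (hcent x hx hx1)
    have h5 : e ∣ p ^ m := by
      rw [← hm, h4, sq, mul_assoc]; exact dvd_mul_right _ _
    exact ((Nat.dvd_prime_pow hp).1 h5).imp fun a ha => ha.2
  have hp2 : p ≠ 2 := fun h => he2 ⟨a, h ▸ ha⟩
  have ha0 : a ≠ 0 := fun h => by rw [ha, h, pow_zero] at he; exact lt_irrefl _ he
  -- The class of `g` is a union of cosets, so `|C(g)|` divides `e²(|N| - 1)`, whose second factor
  -- is prime to `p`.
  have hdvd : ∀ g ∉ N, ∀ P : Subgroup G, IsPGroup p P → P ≤ centralizer {g} →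
      Nat.card P ∣ e ^ 2 := by
    intro g hg P hP hPg
    have h1 : Nat.card (centralizer {g}) * Nat.card N ∣ Nat.card G := by
      refine card_centralizer_mul_card_dvd fun b hb y hy => hb.trans (hcoset b (fun h => hg ?_) y hy)
      obtain ⟨c, hc⟩ := isConj_iff.1 hb.symm
      exact hc ▸ hN.conj_mem b h c
    rw [hcard, mul_right_comm] at h1
    have h3 := (card_dvd_of_le hPg).trans (Nat.dvd_of_mul_dvd_mul_right Nat.card_pos h1)
    obtain ⟨j, hj⟩ := IsPGroup.iff_card.1 hP
    rw [hj] at h3 ⊢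
    exact (Nat.Coprime.pow_left j hcop).dvd_of_dvd_mul_right h3
  obtain ⟨g, hg, hgc⟩ := hN.exists_notMem_forall_commute hN1 hp hp2 hord hpN hcomm hcent
    (b := a * 2) (by simpa using ha0) (by rw [hcard, ha, pow_mul, mul_right_comm])
    (by rw [pow_mul, ← ha]; exact hdvd)
  refine Nat.le_of_dvd (by positivity) (hdvd g hg N hpN fun y hy => ?_)
  rw [mem_centralizer_singleton_iff]
  exact (hgc y hy).symm

/-! ### Numerical estimate and conclusion -/

theorem Nat.twelve_mul_cube_le_factorial_two_mul {e : ℕ} (he : 3 ≤ e) :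
    12 * e ^ 3 ≤ (2 * e).factorial := by
  obtain ⟨k, rfl⟩ := Nat.exists_eq_add_of_le he
  have h1 : (2 * (3 + k)).factorial
      = (2 * k + 6) * ((2 * k + 5) * ((2 * k + 4) * (2 * k + 3).factorial)) := by
    rw [show 2 * (3 + k) = 2 * k + 3 + 1 + 1 + 1 by ring, Nat.factorial_succ, Nat.factorial_succ,
      Nat.factorial_succ]
  have h2 : 6 ≤ (2 * k + 3).factorial := Nat.factorial_le (by omega : 3 ≤ 2 * k + 3)
  rw [h1]
  calc 12 * (3 + k) ^ 3 = (2 * (3 + k)) * ((3 + k) * ((3 + k) * 6)) := by ring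
    _ ≤ _ := Nat.mul_le_mul (by omega)
      (Nat.mul_le_mul (by omega) (Nat.mul_le_mul (by omega) h2))

theorem Representation.card_lt_pow_six {G : Type u} [Group G] [Finite G]
    {V : Type v} [AddCommGroup V] [Module ℂ V] {ρ : Representation ℂ G V} [ρ.IsIrreducible]
    {N : Subgroup G} (h : ActsTriviallyOnOtherSimples N ρ) (hN : N.Normal) (hN1 : N ≠ ⊥) {e : ℕ}
    (hn : Module.finrank ℂ V * (Module.finrank ℂ V + e) = Nat.card G)
    (he : 1 < e) (he2 : ¬ ∃ m : ℕ, e = 2 ^ m) : Nat.card G < e ^ 6 := by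
  have hcard := h.card_eq hN hN1 hn
  have hle : Nat.card N ≤ e ^ 2 := hN.card_le_sq hN1
    (fun x hx y hy hx1 hy1 => h.isConj_of_mem hN hN1 hx hy hx1 hy1)
    (fun g hg y hy => h.isConj_mul hN hN1 hg hy) he he2 hcard
  have he0 : 0 < e ^ 2 := by positivity
  rw [hcard, show e ^ 6 = e ^ 2 * e ^ 2 * e ^ 2 by ring]
  refine Nat.mul_lt_mul_of_le_of_lt (Nat.mul_le_mul_left _ hle) ?_ (by positivity)
  omega

theorem mainTheorem9 {G : Type u} [Group G] [Finite G]
    {V : Type v} [AddCommGroup V] [Module ℂ V]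
    (ρ : Representation ℂ G V) (hρ : ρ.IsIrreducible)
    (d e : ℕ) (hd : Module.finrank ℂ V = d) (hn : d * (d + e) = Nat.card G)
    (he : 1 < e) (he2 : ¬ ∃ m : ℕ, e = 2 ^ m) :
    Nat.card G ≤ (Nat.factorial (2 * e)) ^ 2 ∧
      ((∃ N : Subgroup G, N.Normal ∧ N ≠ ⊥ ∧ ActsTriviallyOnOtherSimples N ρ) →
        Nat.card G < e ^ 6) := by
  have h6 : (∃ N : Subgroup G, N.Normal ∧ N ≠ ⊥ ∧ ActsTriviallyOnOtherSimples N ρ) →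
      Nat.card G < e ^ 6 := fun ⟨N, hN, hN1, h⟩ =>
    Representation.card_lt_pow_six h hN hN1 (by rw [hd, hn]) he he2
  refine ⟨?_, h6⟩
  have he3 : 3 ≤ e := by
    rcases Nat.lt_or_ge e 3 with h | h
    · exact absurd ⟨1, by omega⟩ he2
    · exact h
  -- There is slack here: the case `d < 4e³` needs only `20e⁶`, the other case only `e⁶`.
  have hfac : 144 * e ^ 6 ≤ (2 * e).factorial ^ 2 := by
    calc 144 * e ^ 6 = (12 * e ^ 3) ^ 2 := by ring
      _ ≤ _ := Nat.pow_le_pow_left (Nat.twelve_mul_cube_le_factorial_two_mul he3) 2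
  refine le_trans ?_ hfac
  rcases le_or_gt (4 * e ^ 3) d with hde | hde
  · have := h6 (ρ.exists_normal_actsTriviallyOnOtherSimples hd hn (by omega) hde)
    omega
  · rw [← hn]
    have h1 : e ≤ e ^ 3 := Nat.le_self_pow (by norm_num) e
    calc d * (d + e) ≤ (4 * e ^ 3) * (4 * e ^ 3 + e ^ 3) := by gcongr
      _ = 20 * e ^ 6 := by ring
      _ ≤ 144 * e ^ 6 := by omega
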